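/- Let $n\ge 2$. A bilinear system of type I of dimension $n$ is a system $$\dot x=(A+uN)x+bu,\qquad x(0)=0,\qquad y=cx,$$ given by a 4-tuple $\sigma=(A,N,b,c)$ with $A,N\in\mathbb R^{n\times n}$, $b\in\mathbb R^{n\times 1}$, $c\in\mathbb R^{1\times n}$; the class $\mathcal S^I_n$ of these systems is identified with $\mathbb R^{2n^2+2n}$. Inputs are Lebesgue measurable, essentially bounded functions $u:[0,T_u]\to\mathbb R$ with $T_u\ge 0$. Two systems are i/o equivalent under an input $u$ if the corresponding outputs satisfy $y(t)=\widehat y(t)$ for all $t\in[0,T_u]$, and they are i/o equivalent if this holds for every input. A subset of $\mathcal S^I_n$ is generic if it is open and dense and its complement has Lebesgue measure zero. There is a generic subset $\mathcal G$ of $\mathcal S^I_n$ such that for every $\sigma\in\mathcal G$ there is some $\widehat\sigma\in\mathcal G$ such that 1. $\sigma$ and $\widehat\sigma$ are i/o equivalent under every constant input, but 2. $\sigma$ and $\widehat\sigma$ are not i/o equivalent. -/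

import Mathlib

open scoped Matrix

namespace BilinearID

/-- An input: a Lebesgue measurable, essentially bounded function on an interval `[0, T]`.
Only the values of `val` on `[0, T]` (`T = duration`) are ever used. -/
structure Input where
  duration : ℝ
  duration_nonneg : 0 ≤ duration
  val : ℝ → ℝ
  memLp : MeasureTheory.MemLp val ⊤
    (MeasureTheory.volume.restrict (Set.Icc (0 : ℝ) duration))

/-- The inputs that are constant on their interval of definition (any value, any duration). -/
def constantInputs : Set Input :=
  {u | ∃ β : ℝ, ∀ t ∈ Set.Icc (0 : ℝ) u.duration, u.val t = β}

/-- The class of `n`-dimensional bilinear systems of type I, identified with the space of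
4-tuples `(A, N, b, c)`, that is, with `ℝ ^ (2 n ^ 2 + 2 n)`. The topology and the measure
`volume` are those of this finite product of copies of `ℝ` (Lebesgue measure). -/
abbrev TypeI (n : ℕ) : Type :=
  (Fin n → Fin n → ℝ) × (Fin n → Fin n → ℝ) × (Fin n → ℝ) × (Fin n → ℝ)

namespace TypeI

variable {n : ℕ}

/-- The matrix `A` of the 4-tuple `(A, N, b, c)`. -/
def A (σ : TypeI n) : Matrix (Fin n) (Fin n) ℝ := Matrix.of σ.1

/-- The matrix `N` of the 4-tuple `(A, N, b, c)`. -/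
def N (σ : TypeI n) : Matrix (Fin n) (Fin n) ℝ := Matrix.of σ.2.1

/-- The column vector `b` of the 4-tuple `(A, N, b, c)`. -/
def b (σ : TypeI n) : Fin n → ℝ := σ.2.2.1

/-- The row vector `c` of the 4-tuple `(A, N, b, c)`. -/
def c (σ : TypeI n) : Fin n → ℝ := σ.2.2.2

/-- `x` is the (Carathéodory) solution on `[0, T]` of
`x' = (A + u N) x + b u`, `x(0) = 0`, written as an integral equation. -/
def IsTrajectory (σ : TypeI n) (u : Input) (x : ℝ → Fin n → ℝ) : Prop :=
  ContinuousOn x (Set.Icc 0 u.duration) ∧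
    ∀ t ∈ Set.Icc (0 : ℝ) u.duration,
      x t = ∫ s in (0 : ℝ)..t, ((σ.A + u.val s • σ.N) *ᵥ x s + u.val s • σ.b)

/-- The two systems are indistinguishable under `u`: the outputs `y = c x` along the solutions
for the input `u` coincide on `[0, T]`. (Each system has exactly one solution on `[0, T]` for
each input, so the quantifiers over solutions only name the two solutions.) -/
def Indistinguishable {m : ℕ} (σ : TypeI n) (σ' : TypeI m) (u : Input) : Prop :=
  ∀ (x : ℝ → Fin n → ℝ) (x' : ℝ → Fin m → ℝ), σ.IsTrajectory u x → σ'.IsTrajectory u x' →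
    ∀ t ∈ Set.Icc (0 : ℝ) u.duration, σ.c ⬝ᵥ x t = σ'.c ⬝ᵥ x' t

/-- Input/output equivalence with respect to all inputs in `U`. -/
def IOEquivOn {m : ℕ} (U : Set Input) (σ : TypeI n) (σ' : TypeI m) : Prop :=
  ∀ u ∈ U, Indistinguishable σ σ' u

/-- Input/output equivalence (with respect to all inputs). -/
def IOEquiv {m : ℕ} (σ : TypeI n) (σ' : TypeI m) : Prop :=
  IOEquivOn Set.univ σ σ'

/-- A set of systems is generic if it is open and dense and its complement has Lebesgue
measure zero. -/
def IsGeneric (S : Set (TypeI n)) : Prop :=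
  MeasureTheory.volume Sᶜ = 0 ∧ IsOpen S ∧ Dense S

end TypeI

end BilinearID

open MeasureTheory Set

/-! The partner of `σ` is its transpose `(Aᵀ, Nᵀ, c, b)`. Under a constant input `β` the system is
linear with `M = A + βN` and kernel `β c e^{tM} b`, a scalar and so equal to its own transpose:
constant inputs cannot separate the two. Transposition does reverse products, however, exchanging
the Volterra coefficients `c A N b` and `c N A b`. An input that switches from 1 to 0 reveals `c A
(A + N) b`; since `c A² b` is invariant, equivalence would force `volterraGap`, that is `c (AN - NA)
b`, to vanish. The gap changes sign under transposition, so the set where it is nonzero contains the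
partner too, and for `n ≥ 2` this set is generic. -/

/-- A nonzero linear functional on a finite-dimensional space vanishes almost nowhere. -/
theorem ae_linearMap_ne_zero {E : Type*} [NormedAddCommGroup E] [NormedSpace ℝ E]
    [MeasurableSpace E] [BorelSpace E] [FiniteDimensional ℝ E] (μ : Measure E)
    [μ.IsAddHaarMeasure] (f : E →ₗ[ℝ] ℝ) (v : E) (hv : f v ≠ 0) : ∀ᵐ x ∂μ, f x ≠ 0 := by
  have h : f.ker ≠ ⊤ := fun h => hv (by
    have : v ∈ f.ker := h ▸ Submodule.mem_top
    simpa using this)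
  have h0 := Measure.addHaar_submodule μ f.ker h
  rw [ae_iff]
  convert h0 using 2
  ext x
  simp

theorem hasDerivAt_dotProduct {ι : Type*} [Fintype ι] {f g : ℝ → ι → ℝ} {f' g' : ι → ℝ} {t : ℝ}
    (hf : HasDerivAt f f' t) (hg : HasDerivAt g g' t) :
    HasDerivAt (fun s => f s ⬝ᵥ g s) (f' ⬝ᵥ g t + f t ⬝ᵥ g') t := by
  simp only [dotProduct, ← Finset.sum_add_distrib]
  exact HasDerivAt.fun_sum fun i _ => (hasDerivAt_pi.1 hf i).mul (hasDerivAt_pi.1 hg i)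

theorem hasDerivAt_const_dotProduct {ι : Type*} [Fintype ι] (v : ι → ℝ) {g : ℝ → ι → ℝ}
    {g' : ι → ℝ} {t : ℝ} (hg : HasDerivAt g g' t) :
    HasDerivAt (fun s => v ⬝ᵥ g s) (v ⬝ᵥ g') t := by
  simpa using hasDerivAt_dotProduct (hasDerivAt_const t v) hg

theorem continuous_matrix_mulVec {ι : Type*} [Fintype ι] (M : Matrix ι ι ℝ) :
    Continuous fun v : ι → ℝ => M *ᵥ v := by fun_prop

theorem exists_linear_ode_solution {ι : Type*} [Fintype ι] [DecidableEq ι] (M : Matrix ι ι ℝ)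
    (v : ι → ℝ) (t₀ : ℝ) :
    ∃ x : ℝ → ι → ℝ, x t₀ = v ∧ ∀ t, HasDerivAt x (M *ᵥ x t) t := by
  let L : (ι → ℝ) →L[ℝ] (ι → ℝ) := LinearMap.toContinuousLinearMap (Matrix.toLin' M)
  refine ⟨fun t => NormedSpace.exp ((t - t₀) • L) v, by simp, fun t => ?_⟩
  have h := (hasDerivAt_exp_smul_const' (𝕂 := ℝ) L (t - t₀)).comp_sub_const t t₀
  have h2 := h.clm_apply (hasDerivAt_const t v)
  simpa [L] using h2

/-- The primitive `x` of the homogeneous solution `y` with `y 0 = w` works, because `y - M x` has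
derivative zero. No inverse of `M` is needed. -/
theorem exists_affine_ode_solution {ι : Type*} [Fintype ι] [DecidableEq ι] (M : Matrix ι ι ℝ)
    (w : ι → ℝ) :
    ∃ x : ℝ → ι → ℝ, x 0 = 0 ∧ ∀ t, HasDerivAt x (M *ᵥ x t + w) t := by
  obtain ⟨y, hy0, hy⟩ := exists_linear_ode_solution M w 0
  have hyc : Continuous y := continuous_iff_continuousAt.2 fun t => (hy t).continuousAt
  let x : ℝ → ι → ℝ := fun t => ∫ s in (0 : ℝ)..t, y s
  have hx : ∀ t, HasDerivAt x (y t) t := fun t => (hyc.integral_hasStrictDerivAt 0 t).hasDerivAt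
  have hx0 : x 0 = 0 := by simp [x]
  have hMx : ∀ t, HasDerivAt (fun s => M *ᵥ x s) (M *ᵥ y t) t := fun t =>
    hasDerivAt_pi.2 fun i => hasDerivAt_const_dotProduct (M i) (hx t)
  have key : ∀ t, y t = M *ᵥ x t + w := by
    intro t
    have hd : ∀ s, HasDerivAt (fun s => y s - M *ᵥ x s) 0 s := fun s => by
      simpa using (hy s).fun_sub (hMx s)
    have := is_const_of_deriv_eq_zero (fun s => (hd s).differentiableAt)
      (fun s => (hd s).deriv) t 0
    simp only [hx0, hy0, Matrix.mulVec_zero, sub_zero] at this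
    rw [← this]; abel
  exact ⟨x, hx0, fun t => key t ▸ hx t⟩

/-- Two differentiable functions that agree on `[a, ∞)` have the same derivatives there. -/
theorem hasDerivAt_unique_of_eqOn_Ici {f g : ℝ → ℝ} {f' g' a t : ℝ} (h : EqOn f g (Ici a))
    (ht : a ≤ t) (hf : HasDerivAt f f' t) (hg : HasDerivAt g g' t) : f' = g' :=
  UniqueDiffWithinAt.eq_deriv (Ici t) (uniqueDiffOn_Ici t t self_mem_Ici) hf.hasDerivWithinAt
    (hg.hasDerivWithinAt.congr (fun _ hs => h (ht.trans hs)) (h ht))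

namespace BilinearID

/-- The input equal to `1` up to time `h` and to `0` afterwards. -/
noncomputable def pulse (h T : ℝ) (hT : 0 ≤ T) : Input where
  duration := T
  duration_nonneg := hT
  val := (Iic h).indicator 1
  memLp := by
    refine memLp_top_of_bound (C := 1)
      ((stronglyMeasurable_const.indicator measurableSet_Iic).aestronglyMeasurable) ?_
    refine Filter.Eventually.of_forall fun s => ?_
    by_cases hs : s ∈ Iic h <;> simp [hs]

namespace TypeI

variable {n : ℕ}

/-! ### Transposition and constant inputs -/

/-- The transposed (dual) system. -/
def transpose (σ : TypeI n) : TypeI n := (σ.Aᵀ, σ.Nᵀ, σ.c, σ.b)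

@[simp] theorem transpose_A (σ : TypeI n) : σ.transpose.A = σ.Aᵀ := rfl

@[simp] theorem transpose_N (σ : TypeI n) : σ.transpose.N = σ.Nᵀ := rfl

@[simp] theorem transpose_b (σ : TypeI n) : σ.transpose.b = σ.c := rfl

@[simp] theorem transpose_c (σ : TypeI n) : σ.transpose.c = σ.b := rfl

theorem IsTrajectory.exists_hasDerivAt {σ : TypeI n} {u : Input} {x : ℝ → Fin n → ℝ}
    (hx : σ.IsTrajectory u x) {β : ℝ} (hu : ∀ t ∈ Icc (0 : ℝ) u.duration, u.val t = β) :
    ∃ X : ℝ → Fin n → ℝ, X 0 = 0 ∧ EqOn X x (Icc 0 u.duration) ∧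
      ∀ t ∈ Icc (0 : ℝ) u.duration, HasDerivAt X ((σ.A + β • σ.N) *ᵥ X t + β • σ.b) t := by
  -- Extending `x` continuously to the line gives two-sided derivatives even at the endpoints.
  let y : ℝ → Fin n → ℝ := IccExtend u.duration_nonneg ((Icc 0 u.duration).domRestrict x)
  have hyc : Continuous y := (continuousOn_iff_continuous_domRestrict.1 hx.1).Icc_extend'
  have hyx : EqOn y x (Icc 0 u.duration) := fun t ht => by
    simp only [y]; rw [IccExtend_of_mem _ _ ht]; rfl
  let X : ℝ → Fin n → ℝ := fun t => ∫ s in (0 : ℝ)..t, ((σ.A + β • σ.N) *ᵥ y s + β • σ.b)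
  have hX : EqOn X x (Icc 0 u.duration) := fun t ht => by
    rw [hx.2 t ht]
    refine intervalIntegral.integral_congr fun s hs => ?_
    rw [uIcc_of_le ht.1] at hs
    have hs' : s ∈ Icc 0 u.duration := ⟨hs.1, hs.2.trans ht.2⟩
    simp only [hyx hs', hu s hs']
  refine ⟨X, by simp [X], hX, fun t ht => ?_⟩
  rw [hX ht, ← hyx ht]
  exact ((((continuous_matrix_mulVec _).comp hyc).add
    continuous_const).integral_hasStrictDerivAt 0 t).hasDerivAt

/-- Variation of constants, in terms of a solution of the dual equation. -/
theorem dotProduct_eq_integral_dual {M : Matrix (Fin n) (Fin n) ℝ} {b c : Fin n → ℝ}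
    {X w : ℝ → Fin n → ℝ} {T : ℝ} (hT : 0 ≤ T) (hX0 : X 0 = 0)
    (hX : ∀ t ∈ Icc 0 T, HasDerivAt X (M *ᵥ X t + b) t) (hw0 : w 0 = c)
    (hw : ∀ t, HasDerivAt w (Mᵀ *ᵥ w t) t) :
    c ⬝ᵥ X T = ∫ s in (0 : ℝ)..T, w (T - s) ⬝ᵥ b := by
  have hd : ∀ s ∈ uIcc 0 T,
      HasDerivAt (fun s => w (T - s) ⬝ᵥ X s) (w (T - s) ⬝ᵥ b) s := by
    intro s hs
    rw [uIcc_of_le hT] at hs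
    convert hasDerivAt_dotProduct ((hw (T - s)).comp_const_sub T s) (hX s hs) using 1
    rw [dotProduct_add, Matrix.dotProduct_mulVec, Matrix.mulVec_transpose, neg_dotProduct]
    ring
  have hwc : Continuous w := continuous_iff_continuousAt.2 fun t => (hw t).continuousAt
  have hc : Continuous fun s => w (T - s) ⬝ᵥ b := by fun_prop
  rw [intervalIntegral.integral_eq_sub_of_hasDerivAt hd (hc.intervalIntegrable _ _)]
  simp [hX0, hw0]

/-- This is `c e^{tM} b = b e^{tMᵀ} c`: the pairing `w (t - s) ⬝ᵥ v s` does not depend on `s`. -/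
theorem dual_dotProduct_eq {M : Matrix (Fin n) (Fin n) ℝ} {v w : ℝ → Fin n → ℝ}
    (hv : ∀ t, HasDerivAt v (M *ᵥ v t) t) (hw : ∀ t, HasDerivAt w (Mᵀ *ᵥ w t) t) (t : ℝ) :
    w t ⬝ᵥ v 0 = v t ⬝ᵥ w 0 := by
  have hd : ∀ s, HasDerivAt (fun s => w (t - s) ⬝ᵥ v s) 0 s := fun s => by
    convert hasDerivAt_dotProduct ((hw (t - s)).comp_const_sub t s) (hv s) using 1
    rw [Matrix.dotProduct_mulVec, Matrix.mulVec_transpose, neg_dotProduct]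
    ring
  have := is_const_of_deriv_eq_zero (fun s => (hd s).differentiableAt) (fun s => (hd s).deriv) 0 t
  simp only [sub_zero, sub_self] at this
  rw [this, dotProduct_comm]

theorem ioEquivOn_constantInputs_transpose (σ : TypeI n) :
    IOEquivOn constantInputs σ σ.transpose := by
  rintro u ⟨β, hu⟩ x x' hx hx' t ht
  obtain ⟨X, hX0, hXx, hX⟩ := hx.exists_hasDerivAt hu
  obtain ⟨Z, hZ0, hZx, hZ⟩ := hx'.exists_hasDerivAt hu
  simp only [transpose_A, transpose_N, transpose_b, transpose_c] at hZ ⊢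
  rw [← hXx ht, ← hZx ht]
  have hM : σ.Aᵀ + β • σ.Nᵀ = (σ.A + β • σ.N)ᵀ := by
    rw [Matrix.transpose_add, Matrix.transpose_smul]
  rw [hM] at hZ
  obtain ⟨v, hv0, hv⟩ := exists_linear_ode_solution (σ.A + β • σ.N) σ.b 0
  obtain ⟨w, hw0, hw⟩ := exists_linear_ode_solution (σ.A + β • σ.N)ᵀ σ.c 0
  rw [dotProduct_eq_integral_dual ht.1 hX0 (fun s hs => hX s ⟨hs.1, hs.2.trans ht.2⟩) hw0 hw,
    dotProduct_eq_integral_dual ht.1 hZ0 (fun s hs => hZ s ⟨hs.1, hs.2.trans ht.2⟩) hv0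
      (by simpa using hv)]
  refine intervalIntegral.integral_congr fun s _ => ?_
  have := dual_dotProduct_eq hv hw (t - s)
  rw [hv0, hw0] at this
  simp only [dotProduct_smul, this]

/-! ### Switched inputs and Volterra coefficients -/

theorem isTrajectory_pulse (σ : TypeI n) {h T : ℝ} (hh : 0 ≤ h) (hT : 0 ≤ T)
    {x₁ x₂ : ℝ → Fin n → ℝ} (h0 : x₁ 0 = 0)
    (h₁ : ∀ t, HasDerivAt x₁ ((σ.A + σ.N) *ᵥ x₁ t + σ.b) t) (hj : x₂ h = x₁ h)
    (h₂ : ∀ t, HasDerivAt x₂ (σ.A *ᵥ x₂ t) t) :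
    σ.IsTrajectory (pulse h T hT) (fun t => if t ≤ h then x₁ t else x₂ t) := by
  have hc₁ : Continuous x₁ := continuous_iff_continuousAt.2 fun t => (h₁ t).continuousAt
  have hc₂ : Continuous x₂ := continuous_iff_continuousAt.2 fun t => (h₂ t).continuousAt
  refine ⟨(Continuous.if_le hc₁ hc₂ continuous_id continuous_const
    fun t (ht : t = h) => by rw [ht, hj]).continuousOn, fun t ht => ?_⟩
  have hf₁ : Continuous fun s => (σ.A + σ.N) *ᵥ x₁ s + σ.b :=
    ((continuous_matrix_mulVec _).comp hc₁).add continuous_const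
  have hf₂ : Continuous fun s => σ.A *ᵥ x₂ s := (continuous_matrix_mulVec _).comp hc₂
  set F : ℝ → Fin n → ℝ := fun s => (σ.A + (pulse h T hT).val s • σ.N) *ᵥ
    (if s ≤ h then x₁ s else x₂ s) + (pulse h T hT).val s • σ.b with hF
  have hF₁ : ∀ s, s ≤ h → F s = (σ.A + σ.N) *ᵥ x₁ s + σ.b := fun s hs => by
    simp [hF, pulse, hs]
  have hF₂ : ∀ s, h < s → F s = σ.A *ᵥ x₂ s := fun s hs => by
    simp [hF, pulse, hs.not_ge]
  have e₁ : ∀ r, 0 ≤ r → r ≤ h →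
      IntervalIntegrable F volume 0 r ∧ ∫ s in (0 : ℝ)..r, F s = x₁ r := by
    intro r hr hrh
    have e : EqOn (fun s => (σ.A + σ.N) *ᵥ x₁ s + σ.b) F (uIcc 0 r) := fun s hs => by
      rw [uIcc_of_le hr] at hs
      exact (hF₁ s (hs.2.trans hrh)).symm
    refine ⟨(hf₁.intervalIntegrable 0 r).congr fun s hs => e (uIoc_subset_uIcc hs), ?_⟩
    rw [← intervalIntegral.integral_congr e,
      intervalIntegral.integral_eq_sub_of_hasDerivAt (fun s _ => h₁ s)
        (hf₁.intervalIntegrable _ _), h0, sub_zero]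
  by_cases hth : t ≤ h
  · simp only [hth, if_true]
    exact (e₁ t ht.1 hth).2.symm
  · simp only [hth, if_false]
    have hht : h ≤ t := (not_le.1 hth).le
    have e : ∀ s ∈ uIoc h t, σ.A *ᵥ x₂ s = F s := fun s hs => by
      rw [uIoc_of_le hht] at hs
      exact (hF₂ s hs.1).symm
    have hi : IntervalIntegrable F volume h t := (hf₂.intervalIntegrable h t).congr e
    rw [← intervalIntegral.integral_add_adjacent_intervals (e₁ h hh le_rfl).1 hi,
      (e₁ h hh le_rfl).2, ← intervalIntegral.integral_congr_ae (Filter.Eventually.of_forall e),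
      intervalIntegral.integral_eq_sub_of_hasDerivAt (fun s _ => h₂ s)
        (hf₂.intervalIntegrable _ _), hj]
    abel

/-- A coefficient of the Volterra series that is determined by the input/output behaviour. -/
theorem IOEquiv.dotProduct_eq {m : ℕ} {σ : TypeI n} {σ' : TypeI m} (H : IOEquiv σ σ') :
    σ.c ⬝ᵥ (σ.A *ᵥ ((σ.A + σ.N) *ᵥ σ.b)) =
      σ'.c ⬝ᵥ (σ'.A *ᵥ ((σ'.A + σ'.N) *ᵥ σ'.b)) := by
  obtain ⟨x, hx0, hx⟩ := exists_affine_ode_solution (σ.A + σ.N) σ.b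
  obtain ⟨y, hy0, hy⟩ := exists_affine_ode_solution (σ'.A + σ'.N) σ'.b
  have s₁ : EqOn (fun h => σ.c ⬝ᵥ (σ.A *ᵥ x h)) (fun h => σ'.c ⬝ᵥ (σ'.A *ᵥ y h)) (Ici 0) := by
    intro h hh
    obtain ⟨x₂, hxj, hx₂⟩ := exists_linear_ode_solution σ.A (x h) h
    obtain ⟨y₂, hyj, hy₂⟩ := exists_linear_ode_solution σ'.A (y h) h
    have key : EqOn (fun t => σ.c ⬝ᵥ x₂ t) (fun t => σ'.c ⬝ᵥ y₂ t) (Ici h) := by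
      intro t ht
      have ht0 : 0 ≤ t := le_trans hh ht
      have := H (pulse h t ht0) (mem_univ _) _ _ (σ.isTrajectory_pulse hh ht0 hx0 hx hxj hx₂)
        (σ'.isTrajectory_pulse hh ht0 hy0 hy hyj hy₂) t ⟨ht0, le_rfl⟩
      rcases eq_or_lt_of_le (show h ≤ t from ht) with rfl | hlt
      · simpa [hxj, hyj] using this
      · simpa [hlt.not_ge] using this
    -- The right derivative at the switching time `h` brings out the factor `A`; two derivatives in
    -- `h` then reach `A + N` and `b`.
    have := hasDerivAt_unique_of_eqOn_Ici key le_rfl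
      (hasDerivAt_const_dotProduct σ.c (hx₂ h)) (hasDerivAt_const_dotProduct σ'.c (hy₂ h))
    simpa [hxj, hyj] using this
  have hd : ∀ {k : ℕ} (c b : Fin k → ℝ) (A M : Matrix (Fin k) (Fin k) ℝ) (z : ℝ → Fin k → ℝ),
      (∀ t, HasDerivAt z (M *ᵥ z t + b) t) → ∀ t,
      HasDerivAt (fun h => c ⬝ᵥ (A *ᵥ z h)) (c ⬝ᵥ (A *ᵥ (M *ᵥ z t + b))) t :=
    fun c b A M z hz t => by
      simp only [Matrix.dotProduct_mulVec c A]
      exact hasDerivAt_const_dotProduct _ (hz t)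
  -- The constants `c A b` are carried along on both sides; the next derivative removes them.
  have s₂ : EqOn (fun t => (σ.c ᵥ* σ.A) ⬝ᵥ ((σ.A + σ.N) *ᵥ x t) + (σ.c ᵥ* σ.A) ⬝ᵥ σ.b)
      (fun t => (σ'.c ᵥ* σ'.A) ⬝ᵥ ((σ'.A + σ'.N) *ᵥ y t) + (σ'.c ᵥ* σ'.A) ⬝ᵥ σ'.b)
      (Ici 0) := fun t ht => by
    have := hasDerivAt_unique_of_eqOn_Ici s₁ ht (hd _ _ _ _ x hx t) (hd _ _ _ _ y hy t)
    simpa only [Matrix.dotProduct_mulVec, dotProduct_add, Matrix.mulVec_add] using this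
  have := hasDerivAt_unique_of_eqOn_Ici s₂ le_rfl ((hd _ _ _ _ x hx 0).add_const _)
    ((hd _ _ _ _ y hy 0).add_const _)
  simpa only [hx0, hy0, Matrix.mulVec_zero, zero_add, ← Matrix.dotProduct_mulVec] using this

/-! ### Genericity of a nonzero gap -/

/-- The difference `c A N b - c N A b` of two Volterra coefficients. -/
def volterraGap (σ : TypeI n) : ℝ := σ.c ⬝ᵥ ((σ.A * σ.N - σ.N * σ.A) *ᵥ σ.b)

theorem continuous_volterraGap : Continuous (volterraGap (n := n)) := by
  have hA : Continuous (A (n := n)) := continuous_fst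
  have hN : Continuous (N (n := n)) := continuous_fst.comp continuous_snd
  have hb : Continuous (b (n := n)) := continuous_fst.comp (continuous_snd.comp continuous_snd)
  have hc : Continuous (c (n := n)) := continuous_snd.comp (continuous_snd.comp continuous_snd)
  exact hc.dotProduct (((hA.matrix_mul hN).sub (hN.matrix_mul hA)).matrix_mulVec hb)

theorem volterraGap_transpose (σ : TypeI n) : σ.transpose.volterraGap = -σ.volterraGap := by
  have h : σ.Aᵀ * σ.Nᵀ - σ.Nᵀ * σ.Aᵀ = (-(σ.A * σ.N - σ.N * σ.A))ᵀ := by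
    simp [Matrix.transpose_mul]
  simp only [volterraGap, transpose_A, transpose_N, transpose_b, transpose_c]
  rw [h, Matrix.mulVec_transpose, dotProduct_comm, ← Matrix.dotProduct_mulVec, Matrix.neg_mulVec,
    dotProduct_neg]

theorem not_ioEquiv_transpose {σ : TypeI n} (h : σ.volterraGap ≠ 0) :
    ¬ IOEquiv σ σ.transpose := by
  intro H
  have := H.dotProduct_eq
  apply h
  have e : σ.Aᵀ *ᵥ ((σ.Aᵀ + σ.Nᵀ) *ᵥ σ.c) = ((σ.A + σ.N) * σ.A)ᵀ *ᵥ σ.c := by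
    rw [Matrix.mulVec_mulVec, ← Matrix.transpose_add, ← Matrix.transpose_mul]
  simp only [transpose_A, transpose_N, transpose_b, transpose_c] at this
  rw [e, Matrix.mulVec_transpose, dotProduct_comm σ.b, ← Matrix.dotProduct_mulVec,
    Matrix.mulVec_mulVec, ← sub_eq_zero, ← dotProduct_sub, ← Matrix.sub_mulVec] at this
  rw [volterraGap, ← this]
  congr 2
  noncomm_ring

/-- Fubini, one component at a time: for almost every `A` some off-diagonal entry is nonzero, and
then the successive conditions on `N`, `b` and `c` are each the nonvanishing of a nonzero linear
functional. -/
theorem ae_volterraGap_ne_zero (hn : 2 ≤ n) : ∀ᵐ σ : TypeI n, σ.volterraGap ≠ 0 := by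
  let i : Fin n := ⟨0, by omega⟩
  let j : Fin n := ⟨1, by omega⟩
  have hij : i ≠ j := by simp [i, j]
  have ho : IsOpen {σ : TypeI n | σ.volterraGap ≠ 0} :=
    isOpen_ne_fun continuous_volterraGap continuous_const
  have hA : ∀ᵐ A : Fin n → Fin n → ℝ, A i j ≠ 0 :=
    ae_linearMap_ne_zero volume (LinearMap.proj j ∘ₗ LinearMap.proj i : (Fin n → Fin n → ℝ) →ₗ[ℝ] ℝ)
      (fun _ _ => 1) (by simp)
  refine (Measure.ae_prod_mem_iff_ae_ae_mem ho.measurableSet).2 ?_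
  filter_upwards [hA] with A hA
  have ho₁ := ho.preimage (Continuous.prodMk_right A)
  refine (Measure.ae_prod_mem_iff_ae_ae_mem ho₁.measurableSet).2 ?_
  let f : (Fin n → Fin n → ℝ) →ₗ[ℝ] ℝ :=
    { toFun := fun N => (Matrix.of A * Matrix.of N - Matrix.of N * Matrix.of A) i i
      map_add' := fun N N' => by
        simp only [← Matrix.of_add_of, Matrix.mul_add, Matrix.add_mul, Matrix.sub_apply,
          Matrix.add_apply]
        ring
      map_smul' := fun r N => by
        simp only [← Matrix.smul_of, Matrix.mul_smul, Matrix.smul_mul, Matrix.sub_apply,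
          Matrix.smul_apply, RingHom.id_apply, smul_eq_mul]
        ring }
  -- For this matrix unit the `(i, i)` entry of the commutator is `A i j`, as `i ≠ j`.
  have hf : f (Matrix.single j i 1) ≠ 0 := by
    change (Matrix.of A * Matrix.single j i (1 : ℝ) - Matrix.single j i (1 : ℝ) * Matrix.of A :
      Matrix (Fin n) (Fin n) ℝ) i i ≠ 0
    simpa [hij] using hA
  filter_upwards [ae_linearMap_ne_zero volume f _ hf] with N hN
  have ho₂ := ho₁.preimage (Continuous.prodMk_right N)
  refine (Measure.ae_prod_mem_iff_ae_ae_mem ho₂.measurableSet).2 ?_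
  set K : Matrix (Fin n) (Fin n) ℝ := Matrix.of A * Matrix.of N - Matrix.of N * Matrix.of A with hK
  replace hN : K i i ≠ 0 := hN
  filter_upwards [ae_linearMap_ne_zero volume (LinearMap.proj i ∘ₗ K.mulVecLin) (Pi.single i 1)
    (by simpa [Matrix.mulVec_single] using hN)] with b hb
  have hc : (K *ᵥ b) ⬝ᵥ Pi.single i 1 ≠ 0 := by simpa using hb
  filter_upwards [ae_linearMap_ne_zero volume (dotProductBilin ℝ ℝ (K *ᵥ b)) (Pi.single i 1) hc]
    with c hc
  change c ⬝ᵥ (K *ᵥ b) ≠ 0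
  rw [dotProduct_comm]
  exact hc

theorem isGeneric_volterraGap_ne_zero (hn : 2 ≤ n) :
    IsGeneric {σ : TypeI n | σ.volterraGap ≠ 0} :=
  haveI : (volume : Measure (Fin n → Fin n → ℝ)).IsOpenPosMeasure :=
    Measure.pi.isOpenPosMeasure fun _ => (volume : Measure (Fin n → ℝ))
  haveI : (volume : Measure (TypeI n)).IsOpenPosMeasure :=
    Measure.prod.instIsOpenPosMeasure
  ⟨ae_volterraGap_ne_zero hn, isOpen_ne_fun continuous_volterraGap continuous_const,
    Measure.dense_of_ae (ae_volterraGap_ne_zero hn)⟩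

end TypeI

end BilinearID

theorem corollary2 (n : ℕ) (hn : 2 ≤ n) :
    ∃ G : Set (BilinearID.TypeI n), BilinearID.TypeI.IsGeneric G ∧
      ∀ σ ∈ G, ∃ σ' ∈ G,
        BilinearID.TypeI.IOEquivOn BilinearID.constantInputs σ σ' ∧
          ¬ BilinearID.TypeI.IOEquiv σ σ' := by
  refine ⟨{σ | σ.volterraGap ≠ 0}, BilinearID.TypeI.isGeneric_volterraGap_ne_zero hn,
    fun σ hσ => ⟨σ.transpose, ?_, σ.ioEquivOn_constantInputs_transpose,
      BilinearID.TypeI.not_ioEquiv_transpose hσ⟩⟩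
  rw [mem_ofPred_eq, BilinearID.TypeI.volterraGap_transpose]
  exact neg_ne_zero.2 hσ
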